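/- For $m\ge 1$ a subgroup $G$ of $GL(m,\mathbb C)$ is called algebraic if it is the set of common zeros in $GL(m,\mathbb C)$ of a set of polynomials in the matrix entries. Its Lie algebra is the set of all $X\in gl(m,\mathbb C)$ with $dP_{1}(X)=0$ for every polynomial $P$ in the matrix entries that vanishes on $G$, where $dP_1$ is the differential of $P$ at the identity. A Lie subalgebra of $gl(m,\mathbb C)$ is called algebraic if it is the Lie algebra of some algebraic subgroup of $GL(m,\mathbb C)$. For $n\ge 3$ let $L_n$ be the model filiform Lie algebra, with basis $e_1,\dots,e_n$ and brackets $[e_1,e_i]=e_{i+1}$ for $2\le i\le n-1$, $[e_1,e_n]=0$, and $[e_i,e_j]=0$ for $i,j\ge 2$. **Corollary.** For every $n\ge 3$ there are an $m$ and an $n$-dimensional nilpotent Lie subalgebra of $gl(m,\mathbb C)$ that is not algebraic. Explicitly: (1) ($n=3$) Let $\alpha,\beta\in\mathbb C$ with $\alpha+\beta\ne 0$. The set $\mathfrak h$ of all matrices $$\begin{pmatrix} x_1+x_2 & x_1+x_2 & 0 & x_1\\ x_1+x_2 & x_1+x_2 & 0 & x_2\\ \alpha x_1+(\beta-1)x_2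 & \beta x_1+(\alpha+1)x_2 & 0 & x_3\\ 0&0&0&0\end{pmatrix},\qquad x_1,x_2,x_3\in\mathbb C,$$ is a $3$-dimensional nilpotent Lie subalgebra of $gl(4,\mathbb C)$, and it is not algebraic. (2) ($n\ge 4$) Let $a,\alpha,\beta\in\mathbb C$ with $a\neq 0$. Write $E_{i,j}$ for the matrix units of size $n+1$ and $A=a(E_{1,1}+E_{1,2}+E_{2,1}+E_{2,2})$, and put $$X_1=A+E_{1,n+1}+\alpha E_{n,1}+\beta E_{n,2}+\sum_{k=4}^{n}\tfrac{k-3}{k-2}E_{k,k-1},$$ $$X_2=A+E_{2,n+1}-E_{3,1}+E_{3,2}+\beta E_{n,1}+\alpha E_{n,2}+\sum_{k=4}^{n}\tfrac{1}{k-2}E_{k,k-1},$$ and $X_i=[X_1,X_{i-1}]$ for $3\le i\le n$. Let $\mathfrak h_n$ be the Lie subalgebra of $gl(n+1,\mathbb C)$ generated by $X_1,\dots,X_n$. Then $\mathfrak h_n$ is nilpotent of dimension $n$, there is an isomorphism of Lie algebras $L_n\to\mathfrak h_n$ with $e_i\mapsto X_i$ for all $i$, and $\mathfrak h_n$ is not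 algebraic. The semisimple part $X_{1,s}$ of $X_1$ in its Chevalley–Jordan decomposition is not in $\mathfrak h_n$; it is $X_{1,s}=X_1^{n-1}/(2a)^{n-2}$, and if $n\ge 5$ or $\alpha=\beta$, then also $X_{1,s}=X_1^{n-2}/(2a)^{n-3}$. -/

import Mathlib

attribute [local instance 100] LieRing.ofAssociativeRing

namespace NonAlgebraicNilpotent

noncomputable section

/-- The point of affine `m²`-space given by the entries of a matrix. -/
def entries {m : ℕ} (A : Matrix (Fin m) (Fin m) ℂ) : Fin m × Fin m → ℂ :=
  fun p => A p.1 p.2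

/-- A subgroup `G` of `GL(m,ℂ)` is an algebraic group if it is the set of all automorphisms
annihilated by some set `S` of polynomial functions of the matrix entries. -/
def IsAlgebraicGroup {m : ℕ} (G : Subgroup (GL (Fin m) ℂ)) : Prop :=
  ∃ S : Set (MvPolynomial (Fin m × Fin m) ℂ),
    ∀ g : GL (Fin m) ℂ, g ∈ G ↔
      ∀ P ∈ S, MvPolynomial.eval (entries (g : Matrix (Fin m) (Fin m) ℂ)) P = 0

/-- The ideal `I(G)` of all polynomials in the matrix entries that vanish on `G`. -/
def groupIdeal {m : ℕ} (G : Subgroup (GL (Fin m) ℂ)) :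
    Ideal (MvPolynomial (Fin m × Fin m) ℂ) :=
  MvPolynomial.vanishingIdeal ℂ
    {x | ∃ g ∈ G, x = entries (g : Matrix (Fin m) (Fin m) ℂ)}

/-- The differential of the polynomial function `P` at the identity matrix, applied to `X`. -/
def diffAtOne {m : ℕ} (P : MvPolynomial (Fin m × Fin m) ℂ) (X : Matrix (Fin m) (Fin m) ℂ) : ℂ :=
  ∑ p : Fin m × Fin m,
    MvPolynomial.eval (entries (1 : Matrix (Fin m) (Fin m) ℂ)) (MvPolynomial.pderiv p P) *
      X p.1 p.2

/-- A Lie subalgebra of `gl(m,ℂ)` is algebraic if it is the Lie algebra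
`{X | dP(X) = 0 for all P ∈ I(G)}` of an algebraic group `G` of automorphisms of `ℂ^m`. -/
def IsAlgebraic {m : ℕ} (L : LieSubalgebra ℂ (Matrix (Fin m) (Fin m) ℂ)) : Prop :=
  ∃ G : Subgroup (GL (Fin m) ℂ), IsAlgebraicGroup G ∧
    ∀ X : Matrix (Fin m) (Fin m) ℂ, X ∈ L ↔ ∀ P ∈ groupIdeal G, diffAtOne P X = 0

/-- `S` is the semisimple part of `X` in the Chevalley-Jordan decomposition
`X = S + (X - S)`: `S` is semisimple, `X - S` is nilpotent and they commute. -/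
def IsSemisimplePart {m : ℕ} (X S : Matrix (Fin m) (Fin m) ℂ) : Prop :=
  Module.End.IsSemisimple (Matrix.toLin' S) ∧ IsNilpotent (X - S) ∧ Commute S (X - S)

/-- The general element of the three-dimensional algebra `h` in `gl(4,ℂ)`. -/
def hMatrix (α β x₁ x₂ x₃ : ℂ) : Matrix (Fin 4) (Fin 4) ℂ :=
  !![x₁ + x₂, x₁ + x₂, 0, x₁;
     x₁ + x₂, x₁ + x₂, 0, x₂;
     α * x₁ + (β - 1) * x₂, β * x₁ + (α + 1) * x₂, 0, x₃;
     0, 0, 0, 0]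

/-- The matrix `X₁` in `gl(n+1,ℂ)`; rows and columns are numbered from `0`. -/
def matX₁ (n : ℕ) (a α β : ℂ) : Matrix (Fin (n + 1)) (Fin (n + 1)) ℂ :=
  Matrix.of fun i j =>
    if (i : ℕ) < 2 ∧ (j : ℕ) < 2 then a
    else if (i : ℕ) = 0 ∧ (j : ℕ) = n then 1
    else if (i : ℕ) + 1 = n ∧ (j : ℕ) = 0 then α
    else if (i : ℕ) + 1 = n ∧ (j : ℕ) = 1 then β
    else if 2 ≤ (j : ℕ) ∧ (i : ℕ) = (j : ℕ) + 1 ∧ (i : ℕ) < n then ((j : ℂ) - 1) / (j : ℂ)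
    else 0

/-- The matrix `X₂` in `gl(n+1,ℂ)`; rows and columns are numbered from `0`. -/
def matX₂ (n : ℕ) (a α β : ℂ) : Matrix (Fin (n + 1)) (Fin (n + 1)) ℂ :=
  Matrix.of fun i j =>
    if (i : ℕ) < 2 ∧ (j : ℕ) < 2 then a
    else if (i : ℕ) = 1 ∧ (j : ℕ) = n then 1
    else if (i : ℕ) = 2 ∧ (j : ℕ) = 0 then -1
    else if (i : ℕ) = 2 ∧ (j : ℕ) = 1 then 1
    else if (i : ℕ) + 1 = n ∧ (j : ℕ) = 0 then β
    else if (i : ℕ) + 1 = n ∧ (j : ℕ) = 1 then α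
    else if 2 ≤ (j : ℕ) ∧ (i : ℕ) = (j : ℕ) + 1 ∧ (i : ℕ) < n then 1 / (j : ℂ)
    else 0

/-- The sequence `X₁, X₂, X₃ = [X₁, X₂], X₄ = [X₁, X₃], …`; `genX n a α β k` is `X_{k+1}`. -/
def genX (n : ℕ) (a α β : ℂ) : ℕ → Matrix (Fin (n + 1)) (Fin (n + 1)) ℂ
  | 0 => matX₁ n a α β
  | 1 => matX₂ n a α β
  | k + 2 => ⁅matX₁ n a α β, genX n a α β (k + 1)⁆

/-- The Lie subalgebra `h_n` of `gl(n+1,ℂ)` generated by `X₁, …, X_n`. -/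
def hAlg (n : ℕ) (a α β : ℂ) : LieSubalgebra ℂ (Matrix (Fin (n + 1)) (Fin (n + 1)) ℂ) :=
  LieSubalgebra.lieSpan ℂ _ (Set.range fun k : Fin n => genX n a α β k)

/-- The underlying space of the model filiform Lie algebra `L_n`. -/
def ModelFiliform (n : ℕ) : Type := Fin n → ℂ

namespace ModelFiliform

instance (n : ℕ) : AddCommGroup (ModelFiliform n) := inferInstanceAs (AddCommGroup (Fin n → ℂ))

instance (n : ℕ) : Module ℂ (ModelFiliform n) := inferInstanceAs (Module ℂ (Fin n → ℂ))

/-- The standard basis vector; `e n k` is the basis element with number `k + 1`. -/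
def e (n : ℕ) (k : Fin n) : ModelFiliform n := (Pi.single k 1 : Fin n → ℂ)

/-- The bracket of `L_n`, in coordinates; see `bracket_e_first` and `bracket_e_e`. -/
instance (n : ℕ) : Bracket (ModelFiliform n) (ModelFiliform n) where
  bracket x y := fun k =>
    if 2 ≤ (k : ℕ) then
      x ⟨0, k.pos⟩ * y ⟨k - 1, by omega⟩ - x ⟨k - 1, by omega⟩ * y ⟨0, k.pos⟩
    else 0

theorem bracket_apply {n : ℕ} (x y : ModelFiliform n) (k : Fin n) :
    ⁅x, y⁆ k = if 2 ≤ (k : ℕ) then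
      x ⟨0, k.pos⟩ * y ⟨k - 1, by omega⟩ - x ⟨k - 1, by omega⟩ * y ⟨0, k.pos⟩ else 0 := rfl

theorem add_apply {n : ℕ} (x y : ModelFiliform n) (k : Fin n) : (x + y) k = x k + y k := rfl

theorem smul_apply {n : ℕ} (c : ℂ) (x : ModelFiliform n) (k : Fin n) : (c • x) k = c * x k := rfl

theorem zero_apply {n : ℕ} (k : Fin n) : (0 : ModelFiliform n) k = 0 := rfl

instance (n : ℕ) : LieRing (ModelFiliform n) where
  add_lie x y z := by
    funext k
    simp only [bracket_apply, add_apply]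
    split_ifs <;> ring
  lie_add x y z := by
    funext k
    simp only [bracket_apply, add_apply]
    split_ifs <;> ring
  lie_self x := by
    funext k
    simp only [bracket_apply, zero_apply]
    split_ifs <;> ring
  leibniz_lie x y z := by
    funext k
    simp only [bracket_apply, add_apply]
    split_ifs <;> first | omega | ring

instance (n : ℕ) : LieAlgebra ℂ (ModelFiliform n) where
  lie_smul c x y := by
    funext k
    simp only [bracket_apply, smul_apply]
    split_ifs <;> ring

theorem e_apply {n : ℕ} (i k : Fin n) : e n i k = if (k : ℕ) = (i : ℕ) then 1 else 0 := by
  exact (Pi.single_apply i (1 : ℂ) k).trans (by simp only [Fin.ext_iff])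

theorem bracket_e_first {n : ℕ} (i : ℕ) (hi : 1 ≤ i) (hn : i + 1 < n) :
    ⁅e n ⟨0, by omega⟩, e n ⟨i, by omega⟩⁆ = e n ⟨i + 1, hn⟩ := by
  funext k
  simp only [bracket_apply, e_apply]
  split_ifs <;> first | omega | simp

theorem bracket_e_last {n : ℕ} (hn : 2 ≤ n) :
    ⁅e n ⟨0, by omega⟩, e n ⟨n - 1, by omega⟩⁆ = 0 := by
  funext k
  simp only [bracket_apply, e_apply, zero_apply]
  split_ifs <;> first | omega | simp

theorem bracket_e_e {n : ℕ} (i j : Fin n) (hi : 1 ≤ (i : ℕ)) (hj : 1 ≤ (j : ℕ)) :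
    ⁅e n i, e n j⁆ = 0 := by
  funext k
  simp only [bracket_apply, e_apply, zero_apply]
  split_ifs <;> first | omega | simp

end ModelFiliform

end

end NonAlgebraicNilpotent

namespace NonAlgebraicNilpotent

/-! The Lie algebra of an algebraic group contains the semisimple part of each of its elements, so a
Lie algebra with an element whose semisimple part lies outside it is not algebraic. Here only
elements `Y` with `Y ^ (k + 1) = c • Y ^ k`, `c ≠ 0`, are needed; their semisimple part is `S = Y ^
k / c ^ (k - 1)`.

To see that `S` is in the Lie algebra, let `D_M` be the left-invariant vector field of a matrix `M`,
acting on polynomials. The ideal of the group is stable under `D_Y`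
(`leftInvariant_mem_groupIdeal`). Polynomials are spanned by vectors that are eigenvectors of `D_S`
and, for the same eigenvalue, generalized eigenvectors of `D_Y`
(`iSup_eigenspace_inf_maxGenEigenspace_eq_top`). Hence each `D_Y`-stable subspace is `D_S`-stable
(`apply_mem_of_invariant`), and evaluating `D_S P` at the identity gives
`IsAlgebraic.scaled_pow_mem`.

The rest is explicit: the given matrices satisfy the relations of the model filiform algebra, `X₁`
satisfies such a power identity with `c = 2a`, and `S` violates a linear relation between matrix
entries that holds on the whole algebra. -/

open Module MvPolynomial

/-! ### Generalized eigenspaces of derivations and of invariant subspaces. -/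

section Derivations

variable {K A : Type*} [Field K] [CommRing A] [Algebra K A]

/-- For a derivation, the product of generalized eigenvectors is a generalized eigenvector. -/
theorem mul_mem_maxGenEigenspace (D : Derivation K A A) {μ ν : K} {p q : A}
    (hp : p ∈ End.maxGenEigenspace (D : A →ₗ[K] A) μ)
    (hq : q ∈ End.maxGenEigenspace (D : A →ₗ[K] A) ν) :
    p * q ∈ End.maxGenEigenspace (D : A →ₗ[K] A) (μ + ν) := by
  set T : K → End K A := fun ρ => (D : A →ₗ[K] A) - algebraMap K (End K A) ρ with hT
  have hmem (ρ : K) (x : A) : x ∈ End.maxGenEigenspace (D : A →ₗ[K] A) ρ ↔ ∃ k, (T ρ ^ k) x = 0 :=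
    End.mem_maxGenEigenspace _ _ _
  obtain ⟨i, hi⟩ := (hmem _ _).1 hp
  obtain ⟨j, hj⟩ := (hmem _ _).1 hq
  clear hp hq
  -- By `key` below, one application of `T (μ + ν)` to `p * q` gives two products, each with one of
  -- the exponents lowered by one; so the induction is on their sum.
  induction h : i + j generalizing i j p q with
  | zero =>
    obtain ⟨rfl, rfl⟩ : i = 0 ∧ j = 0 := by omega
    simp_all
  | succ s ih =>
    rcases i with _ | i
    · simp_all
    rcases j with _ | j
    · simp_all
    have h₁ := ih (i + 1) hi j (q := T ν q) (by rwa [pow_succ] at hj) (by omega)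
    have h₂ := ih i (p := T μ p) (by rwa [pow_succ] at hi) (j + 1) hj (by omega)
    have key : T (μ + ν) (p * q) = p * T ν q + T μ p * q := by
      simp only [hT, LinearMap.sub_apply, Module.algebraMap_end_apply, Derivation.coeFn_coe,
        Derivation.leibniz, smul_eq_mul, Algebra.smul_def (A := A), (algebraMap K A).map_add]
      ring
    obtain ⟨k, hk⟩ := (hmem _ _).1 (key ▸ add_mem h₁ h₂)
    exact (hmem _ _).2 ⟨k + 1, by rw [pow_succ]; exact hk⟩

end Derivations

section InvariantSubmodules

variable {K V : Type*} [Field K] [AddCommGroup V] [Module K V]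

/-- The generalized eigencomponents of an element of an invariant submodule lie in it. -/
theorem mem_of_sum_mem_maxGenEigenspace {f : End K V} {I : Submodule K V}
    (hI : ∀ x ∈ I, f x ∈ I) {v : K →₀ V} (hv : ∀ μ, v μ ∈ f.maxGenEigenspace μ)
    (hs : (v.sum fun _ x => x) ∈ I) (μ : K) : v μ ∈ I := by
  classical
  -- In the quotient by `I` the components stay generalized eigenvectors, for distinct eigenvalues,
  -- and their sum is zero; independence makes each of them zero.
  let g : End K (V ⧸ I) := I.mapQ I f hI
  have hgen (ν : K) : I.mkQ (v ν) ∈ g.maxGenEigenspace ν := by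
    obtain ⟨k, hk⟩ := (End.mem_maxGenEigenspace _ _ _).1 (hv ν)
    refine (End.mem_maxGenEigenspace _ _ _).2 ⟨k, ?_⟩
    have hcomm (x : V) : ((g - ν • (1 : End K (V ⧸ I))) ^ k) (I.mkQ x) =
        I.mkQ (((f - ν • (1 : End K V)) ^ k) x) := by
      clear hk
      induction k generalizing x with
      | zero => rfl
      | succ k ih =>
        rw [pow_succ, End.mul_apply, pow_succ, End.mul_apply, ← ih]
        rfl
    rw [hcomm, hk, map_zero]
  by_cases hμ : μ ∈ v.support
  · rw [← Submodule.Quotient.mk_eq_zero, ← Submodule.mkQ_apply]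
    refine Submodule.disjoint_def.1 (End.independent_maxGenEigenspace g μ) _ (hgen μ) ?_
    rw [Finsupp.sum, ← Submodule.Quotient.mk_eq_zero, ← Submodule.mkQ_apply, map_sum,
      ← Finset.add_sum_erase _ _ hμ] at hs
    rw [eq_neg_of_add_eq_zero_left hs]
    refine neg_mem (sum_mem fun ν hν => ?_)
    exact Submodule.mem_iSup_of_mem ν (Submodule.mem_iSup_of_mem (Finset.ne_of_mem_erase hν) (hgen ν))
  · rw [Finsupp.notMem_support_iff.1 hμ]
    exact I.zero_mem

/-- If `s` acts as `μ` on a space of generalized `μ`-eigenvectors of `f`, for every `μ`, and these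
spaces span, then every `f`-invariant submodule is `s`-invariant. -/
theorem apply_mem_of_invariant {f s : End K V} {I : Submodule K V} (hI : ∀ x ∈ I, f x ∈ I)
    (htop : ⨆ μ, s.eigenspace μ ⊓ f.maxGenEigenspace μ = ⊤) {x : V} (hx : x ∈ I) : s x ∈ I := by
  obtain ⟨v, hv, rfl⟩ := (Submodule.mem_iSup_iff_exists_finsupp _ _).1
    (htop ▸ Submodule.mem_top : x ∈ ⨆ μ, s.eigenspace μ ⊓ f.maxGenEigenspace μ)
  rw [Finsupp.sum, map_sum]
  refine sum_mem fun μ _ => ?_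
  rw [End.mem_eigenspace_iff.1 (hv μ).1]
  exact I.smul_mem _ (mem_of_sum_mem_maxGenEigenspace hI (fun ν => (hv ν).2) hx μ)

end InvariantSubmodules

/-! ### Left-invariant vector fields and the ideal of an algebraic group. -/

section

variable {m : ℕ}

/-- The left-invariant vector field on matrix space with value `M` at the identity. -/
noncomputable def leftInvariant (M : Matrix (Fin m) (Fin m) ℂ) :
    Derivation ℂ (MvPolynomial (Fin m × Fin m) ℂ) (MvPolynomial (Fin m × Fin m) ℂ) :=
  ∑ p : Fin m × Fin m, (∑ k, C (M k p.2) * X (p.1, k) : MvPolynomial (Fin m × Fin m) ℂ) • pderiv p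

/-- The linear form `x ↦ (x v)_i` on matrix space. -/
noncomputable def rowForm (i : Fin m) : (Fin m → ℂ) →ₗ[ℂ] MvPolynomial (Fin m × Fin m) ℂ :=
  ∑ k, (LinearMap.proj k : (Fin m → ℂ) →ₗ[ℂ] ℂ).smulRight (X (i, k))

theorem rowForm_apply (i : Fin m) (v : Fin m → ℂ) :
    rowForm i v = ∑ k, C (v k) * X (i, k) := by
  simp [rowForm, MvPolynomial.smul_eq_C_mul]

theorem leftInvariant_apply (M : Matrix (Fin m) (Fin m) ℂ) (P : MvPolynomial (Fin m × Fin m) ℂ) :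
    leftInvariant M P = ∑ p : Fin m × Fin m, (∑ k, C (M k p.2) * X (p.1, k)) * pderiv p P := by
  rw [leftInvariant, ← Derivation.coeFnAddMonoidHom_apply, map_sum, Finset.sum_apply]
  rfl

theorem leftInvariant_X (M : Matrix (Fin m) (Fin m) ℂ) (p : Fin m × Fin m) :
    leftInvariant M (X p) = ∑ k, C (M k p.2) * X (p.1, k) := by
  rw [leftInvariant_apply, Finset.sum_eq_single p]
  · simp
  · intro q _ hq
    rw [pderiv_X_of_ne (Ne.symm hq), mul_zero]
  · simp

/-- For fixed `i` the linear forms in row `i` are a copy of `ℂ^m` on which the vector field acts as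
the matrix itself. This reduces the spectral theory on polynomials to that of the matrix. -/
theorem leftInvariant_rowForm (M : Matrix (Fin m) (Fin m) ℂ) (i : Fin m) (v : Fin m → ℂ) :
    leftInvariant M (rowForm i v) = rowForm i (M.mulVec v) := by
  simp only [rowForm_apply, map_sum, Derivation.leibniz, leftInvariant_X, derivation_C, mul_zero,
    add_zero, smul_eq_mul, Finset.mul_sum, Matrix.mulVec, dotProduct, Finset.sum_mul, map_mul]
  rw [Finset.sum_comm]
  exact Finset.sum_congr rfl fun _ _ => Finset.sum_congr rfl fun _ _ => by ring

theorem X_eq_rowForm (p : Fin m × Fin m) :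
    (X p : MvPolynomial (Fin m × Fin m) ℂ) = rowForm p.1 (Pi.single p.2 1) := by
  rw [rowForm_apply, Finset.sum_eq_single p.2]
  · simp
  · intro k _ hk
    simp [hk]
  · simp

theorem diffAtOne_eq (P : MvPolynomial (Fin m × Fin m) ℂ) (M : Matrix (Fin m) (Fin m) ℂ) :
    diffAtOne P M = eval (entries (1 : Matrix (Fin m) (Fin m) ℂ)) (leftInvariant M P) := by
  rw [leftInvariant_apply, map_sum, diffAtOne]
  refine Finset.sum_congr rfl fun p _ => ?_
  simp [entries, Matrix.one_apply, mul_comm]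

/-- The pullback of polynomials under left multiplication by `g`. -/
noncomputable def leftTranslate (g : Matrix (Fin m) (Fin m) ℂ) :
    MvPolynomial (Fin m × Fin m) ℂ →ₐ[ℂ] MvPolynomial (Fin m × Fin m) ℂ :=
  aeval fun p => ∑ k, C (g p.1 k) * X (k, p.2)

theorem eval_leftTranslate (g h : Matrix (Fin m) (Fin m) ℂ)
    (P : MvPolynomial (Fin m × Fin m) ℂ) :
    eval (entries h) (leftTranslate g P) = eval (entries (g * h)) P := by
  induction P using MvPolynomial.induction_on with
  | C a => simp [leftTranslate]
  | add p q hp hq => simp [hp, hq]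
  | mul_X p i hp =>
    rw [map_mul, map_mul, map_mul, hp]
    simp [leftTranslate, entries, Matrix.mul_apply]

/-- The field is the derivative of right multiplication by `exp (tM)`, which commutes with left
multiplication by `g`. On generators both sides are the entries of `g x M`. -/
theorem leftInvariant_leftTranslate (g M : Matrix (Fin m) (Fin m) ℂ)
    (P : MvPolynomial (Fin m × Fin m) ℂ) :
    leftInvariant M (leftTranslate g P) = leftTranslate g (leftInvariant M P) := by
  induction P using MvPolynomial.induction_on with
  | C a => simp [leftTranslate]
  | add p q hp hq => simp [hp, hq]
  | mul_X p i hp =>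
    have hX : leftInvariant M (leftTranslate g (X i)) = leftTranslate g (leftInvariant M (X i)) := by
      simp only [leftTranslate, aeval_X, leftInvariant_X, map_sum, map_mul, Derivation.leibniz,
        derivation_C, mul_zero, add_zero, smul_eq_mul, Finset.mul_sum, algHom_C, algebraMap_eq]
      rw [Finset.sum_comm]
      exact Finset.sum_congr rfl fun _ _ => Finset.sum_congr rfl fun _ _ => by ring
    simp only [map_mul, Derivation.leibniz, smul_eq_mul, map_add, hp, hX]

/-- The ideal of a group is stable under the vector fields of its Lie algebra. -/
theorem leftInvariant_mem_groupIdeal {G : Subgroup (GL (Fin m) ℂ)}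
    {M : Matrix (Fin m) (Fin m) ℂ} (hM : ∀ P ∈ groupIdeal G, diffAtOne P M = 0)
    {P : MvPolynomial (Fin m × Fin m) ℂ} (hP : P ∈ groupIdeal G) :
    leftInvariant M P ∈ groupIdeal G := by
  have hmem (Q : MvPolynomial (Fin m × Fin m) ℂ) : Q ∈ groupIdeal G ↔
      ∀ g ∈ G, eval (entries (g : Matrix (Fin m) (Fin m) ℂ)) Q = 0 := by
    simp only [groupIdeal, mem_vanishingIdeal_iff, Set.mem_ofPred_eq, forall_exists_index, and_imp,
      MvPolynomial.aeval_eq_eval]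
    exact ⟨fun h g hg => h _ g hg rfl, fun h x g hg hx => hx ▸ h g hg⟩
  rw [hmem]
  intro g hg
  -- Left translation by `g` preserves the ideal and moves evaluation at `g` to evaluation at the
  -- identity, where the hypothesis on `M` applies.
  have hgP : leftTranslate (g : Matrix (Fin m) (Fin m) ℂ) P ∈ groupIdeal G := by
    rw [hmem]
    intro h hh
    rw [eval_leftTranslate]
    exact (hmem P).1 hP (g * h) (mul_mem hg hh)
  have h := hM _ hgP
  rwa [diffAtOne_eq, leftInvariant_leftTranslate, eval_leftTranslate, mul_one] at h

/-- If `Y S = c S`, `S² = c S` with `c ≠ 0`, and `Yᵏ` is a multiple of `S`, the polynomials are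
spanned by eigenvectors of the vector field of `S` that are generalized eigenvectors, for the same
eigenvalue, of the vector field of `Y`. -/
theorem iSup_eigenspace_inf_maxGenEigenspace_eq_top {Y S : Matrix (Fin m) (Fin m) ℂ} {c : ℂ}
    (hc : c ≠ 0) (hYS : Y * S = c • S) (hSS : S * S = c • S) {k : ℕ} {d : ℂ}
    (hYk : Y ^ k = d • S) :
    ⨆ μ, End.eigenspace (leftInvariant S).toLinearMap μ ⊓
      End.maxGenEigenspace (leftInvariant Y).toLinearMap μ = ⊤ := by
  set W : ℂ → Submodule ℂ (MvPolynomial (Fin m × Fin m) ℂ) := fun μ =>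
    End.eigenspace (leftInvariant S).toLinearMap μ ⊓
      End.maxGenEigenspace (leftInvariant Y).toLinearMap μ with hW
  have hmul {μ ν : ℂ} {p q} (hp : p ∈ W μ) (hq : q ∈ W ν) : p * q ∈ W (μ + ν) := by
    refine ⟨?_, mul_mem_maxGenEigenspace _ hp.2 hq.2⟩
    have h₁ := End.mem_eigenspace_iff.1 hp.1
    have h₂ := End.mem_eigenspace_iff.1 hq.1
    simp only [Derivation.coeFn_coe] at h₁ h₂
    rw [SetLike.mem_coe, End.mem_eigenspace_iff]
    simp only [Derivation.coeFn_coe, Derivation.leibniz, h₁, h₂, smul_eq_mul, add_smul,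
      mul_smul_comm]
    rw [mul_comm q p, add_comm]
  have hrow (i : Fin m) (v : Fin m → ℂ) : rowForm i v ∈ ⨆ μ, W μ := by
    -- `c⁻¹ • S` is a projection. On its image `S` and `Y` both act as `c`; on its kernel `S` is
    -- zero and `Y ^ k = d • S` vanishes, so `Y` is nilpotent there.
    have hv : v = c⁻¹ • S.mulVec v + (v - c⁻¹ • S.mulVec v) := by abel
    rw [hv, map_add]
    refine add_mem (Submodule.mem_iSup_of_mem c ⟨?_, ?_⟩) (Submodule.mem_iSup_of_mem 0 ⟨?_, ?_⟩)
    · rw [SetLike.mem_coe, End.mem_eigenspace_iff, Derivation.coeFn_coe, leftInvariant_rowForm,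
        Matrix.mulVec_smul, Matrix.mulVec_mulVec, hSS, Matrix.smul_mulVec, ← map_smul, smul_comm]
    · refine (End.mem_maxGenEigenspace _ _ _).2 ⟨1, ?_⟩
      rw [pow_one, LinearMap.sub_apply, Derivation.coeFn_coe, leftInvariant_rowForm,
        Matrix.mulVec_smul, Matrix.mulVec_mulVec, hYS, Matrix.smul_mulVec, LinearMap.smul_apply,
        End.one_apply, ← map_smul, smul_comm c⁻¹ c, sub_self]
    · rw [SetLike.mem_coe, End.mem_eigenspace_iff, Derivation.coeFn_coe, leftInvariant_rowForm,
        Matrix.mulVec_sub, Matrix.mulVec_smul, Matrix.mulVec_mulVec, hSS, Matrix.smul_mulVec,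
        inv_smul_smul₀ hc, sub_self, map_zero, zero_smul]
    · refine (End.mem_maxGenEigenspace _ _ _).2 ⟨k, ?_⟩
      have hpow (j : ℕ) (u : Fin m → ℂ) :
          ((leftInvariant Y).toLinearMap ^ j : End ℂ _) (rowForm i u) =
            rowForm i ((Y ^ j).mulVec u) := by
        induction j generalizing u with
        | zero => simp
        | succ j ih =>
          rw [pow_succ, End.mul_apply, Derivation.coeFn_coe, leftInvariant_rowForm, ih,
            Matrix.mulVec_mulVec, pow_succ]
      rw [zero_smul, sub_zero, hpow, hYk, Matrix.smul_mulVec,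
        Matrix.mulVec_sub, Matrix.mulVec_smul, Matrix.mulVec_mulVec, hSS, Matrix.smul_mulVec,
        inv_smul_smul₀ hc, sub_self, smul_zero, map_zero]
  -- Eigenvalues add under multiplication, so the sum of the spaces `W μ` is closed under products;
  -- as it contains constants and coordinates, it is everything.
  have hmulTop {p q} (hp : p ∈ ⨆ μ, W μ) (hq : q ∈ ⨆ μ, W μ) : p * q ∈ ⨆ μ, W μ := by
    induction hp using Submodule.iSup_induction' with
    | zero => simp
    | add x y _ _ hx hy => rw [add_mul]; exact add_mem hx hy
    | mem μ x hx =>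
      induction hq using Submodule.iSup_induction' with
      | zero => simp
      | add y z _ _ hy hz => rw [mul_add]; exact add_mem hy hz
      | mem ν y hy => exact Submodule.mem_iSup_of_mem _ (hmul hx hy)
  refine eq_top_iff.2 fun P _ => ?_
  induction P using MvPolynomial.induction_on with
  | C a =>
    refine Submodule.mem_iSup_of_mem 0 ⟨?_, (End.mem_maxGenEigenspace _ _ _).2 ⟨1, ?_⟩⟩
    · rw [SetLike.mem_coe, End.mem_eigenspace_iff]
      simp
    · simp
  | add p q hp hq => exact add_mem (hp trivial) (hq trivial)
  | mul_X p i hp => exact hmulTop (hp trivial) (X_eq_rowForm i ▸ hrow _ _)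

/-! ### The semisimple part of a matrix with `Y ^ (k + 1) = c • Y ^ k`. -/

section SemisimplePart

variable {Y : Matrix (Fin m) (Fin m) ℂ} {c : ℂ} {k : ℕ}

theorem pow_add_eq_smul_pow (hY : Y ^ (k + 1) = c • Y ^ k) (j : ℕ) :
    Y ^ (k + j) = c ^ j • Y ^ k := by
  induction j with
  | zero => simp
  | succ j ih => rw [← add_assoc, pow_succ, ih, smul_mul_assoc, ← pow_succ, hY, smul_smul, pow_succ]

theorem mul_scaled_pow (hY : Y ^ (k + 1) = c • Y ^ k) (d : ℂ) :
    Y * (d • Y ^ k) = c • (d • Y ^ k) := by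
  rw [mul_smul_comm, ← pow_succ', hY, smul_comm]

theorem scaled_pow_mul_self (hc : c ≠ 0) (hk : 1 ≤ k) (hY : Y ^ (k + 1) = c • Y ^ k) :
    ((c ^ (k - 1))⁻¹ • Y ^ k) * ((c ^ (k - 1))⁻¹ • Y ^ k) = c • ((c ^ (k - 1))⁻¹ • Y ^ k) := by
  obtain ⟨k, rfl⟩ : ∃ l, k = l + 1 := ⟨k - 1, by omega⟩
  rw [smul_mul_smul_comm, ← pow_add, pow_add_eq_smul_pow hY, smul_smul, smul_smul]
  congr 1
  simp only [Nat.add_sub_cancel]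
  field_simp
  ring

/-- The Lie algebra of an algebraic group contains the semisimple part of an element `Y` with
`Y ^ (k + 1) = c Y ^ k`. -/
theorem IsAlgebraic.scaled_pow_mem {L : LieSubalgebra ℂ (Matrix (Fin m) (Fin m) ℂ)}
    (hL : IsAlgebraic L) (hYL : Y ∈ L) (hc : c ≠ 0) (hk : 1 ≤ k)
    (hY : Y ^ (k + 1) = c • Y ^ k) : (c ^ (k - 1))⁻¹ • Y ^ k ∈ L := by
  obtain ⟨G, -, hG⟩ := hL
  rw [hG] at hYL ⊢
  intro P hP
  have htop := iSup_eigenspace_inf_maxGenEigenspace_eq_top (k := k) (d := c ^ (k - 1)) hc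
    (mul_scaled_pow hY (c ^ (k - 1))⁻¹) (scaled_pow_mul_self hc hk hY)
    (by rw [smul_inv_smul₀ (pow_ne_zero _ hc)])
  have hmem := apply_mem_of_invariant (I := (groupIdeal G).restrictScalars ℂ)
    (fun Q hQ => leftInvariant_mem_groupIdeal hYL hQ) htop hP
  simp only [Submodule.restrictScalars_mem, groupIdeal, mem_vanishingIdeal_iff] at hmem
  have := hmem (entries (1 : Matrix (Fin m) (Fin m) ℂ)) ⟨1, one_mem G, by simp⟩
  rw [diffAtOne_eq]
  simpa using this

/-- `S` is annihilated by the squarefree polynomial `X (X - c)`, and `(Y - S) ^ (j + 1) = Y ^ (j +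
1) - c ^ j • S`, which vanishes for `j + 1 = k` by the choice of the scalar in `S`. -/
theorem isSemisimplePart_scaled_pow (hc : c ≠ 0) (hk : 1 ≤ k)
    (hY : Y ^ (k + 1) = c • Y ^ k) : IsSemisimplePart Y ((c ^ (k - 1))⁻¹ • Y ^ k) := by
  set S := (c ^ (k - 1))⁻¹ • Y ^ k with hS
  have hYS : Y * S = c • S := mul_scaled_pow hY _
  have hSS : S * S = c • S := scaled_pow_mul_self hc hk hY
  have hcomm : Commute S Y := ((Commute.refl Y).pow_left k).smul_left _
  refine ⟨?_, ⟨k, ?_⟩, hcomm.sub_right (Commute.refl S)⟩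
  · refine End.isSemisimple_of_squarefree_aeval_eq_zero
      (p := Polynomial.X * (Polynomial.X - Polynomial.C c)) ?_ ?_
    · rw [squarefree_mul_iff]
      refine ⟨?_, Polynomial.prime_X.squarefree, (Polynomial.prime_X_sub_C c).squarefree⟩
      have := (Polynomial.isCoprime_X_sub_C_of_isUnit_sub (a := (0 : ℂ)) (b := c)
        (by simpa using hc)).isRelPrime
      simpa using this
    · rw [map_mul, map_sub, Polynomial.aeval_X, Polynomial.aeval_C, mul_sub, End.mul_eq_comp,
        ← Matrix.toLin'_mul, hSS, map_smul, ← Algebra.commutes, Algebra.smul_def, sub_self]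
  · clear_value S
    have hpow (j : ℕ) : (Y - S) ^ (j + 1) = Y ^ (j + 1) - c ^ j • S := by
      induction j with
      | zero => simp
      | succ j ih =>
        have hYjS : Y ^ (j + 1) * S = c ^ (j + 1) • S := by
          clear ih
          induction j with
          | zero => simpa using hYS
          | succ j ih => rw [pow_succ', mul_assoc, ih, mul_smul_comm, hYS, smul_smul, ← pow_succ]
        rw [pow_succ, ih, sub_mul, mul_sub, mul_sub, hYjS, smul_mul_assoc (c ^ j) S Y,
          smul_mul_assoc (c ^ j) S S, hcomm.eq, hYS, hSS, smul_smul, ← pow_succ, ← pow_succ]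
        abel
    obtain ⟨l, rfl⟩ : ∃ l, k = l + 1 := ⟨k - 1, by omega⟩
    rw [hpow, hS, Nat.add_sub_cancel, smul_inv_smul₀ (pow_ne_zero _ hc), sub_self]

end SemisimplePart

end

/-! ### Dimension and nilpotency of the model filiform algebra. -/

open Matrix

namespace ModelFiliform

theorem eq_sum_e {n : ℕ} (x : ModelFiliform n) : x = ∑ k, x k • e n k :=
  pi_eq_sum_univ' (R := ℂ) (x : Fin n → ℂ)

theorem finrank_eq (n : ℕ) : Module.finrank ℂ (ModelFiliform n) = n :=
  Module.finrank_fin_fun ℂ (n := n)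

instance finiteDimensional (n : ℕ) : FiniteDimensional ℂ (ModelFiliform n) :=
  inferInstanceAs (FiniteDimensional ℂ (Fin n → ℂ))

/-- The first bracket kills the coordinates numbered 0 and 1, and each further one kills the next
coordinate. By Engel's theorem this yields nilpotency. -/
theorem ad_pow_apply_eq_zero {n : ℕ} (x y : ModelFiliform n) (s : ℕ) (k : Fin n)
    (hk : (k : ℕ) ≤ s + 1) : ((LieAlgebra.ad ℂ (ModelFiliform n) x ^ (s + 1)) y) k = 0 := by
  induction s generalizing k with
  | zero =>
    rw [zero_add, pow_one, LieAlgebra.ad_apply, bracket_apply, if_neg (by omega)]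
  | succ s ih =>
    rw [pow_succ', Module.End.mul_apply, LieAlgebra.ad_apply, bracket_apply]
    split_ifs
    · rw [ih ⟨k - 1, by omega⟩ (by simp only; omega), ih ⟨0, k.pos⟩ (by simp)]
      ring
    · rfl

theorem isNilpotent (n : ℕ) : LieRing.IsNilpotent (ModelFiliform n) := by
  rw [LieAlgebra.isNilpotent_iff_forall (R := ℂ)]
  refine fun x => ⟨n + 1, LinearMap.ext fun y => funext fun k => ?_⟩
  exact ad_pow_apply_eq_zero x y n k (by omega)

end ModelFiliform

/-! ### The three-dimensional algebra in `gl(4,ℂ)`. -/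

section LowDimension

/-- The matrices `hMatrix α β x₁ x₂ x₃` form a copy of the Heisenberg algebra. -/
noncomputable def hMatrixHom (α β : ℂ) : ModelFiliform 3 →ₗ⁅ℂ⁆ Matrix (Fin 4) (Fin 4) ℂ where
  toFun x := hMatrix α β (x 0) (x 1) (x 2)
  map_add' x y := by
    ext i j
    fin_cases i <;> fin_cases j <;> simp [hMatrix, ModelFiliform.add_apply] <;> ring
  map_smul' c x := by
    ext i j
    fin_cases i <;> fin_cases j <;> simp [hMatrix, ModelFiliform.smul_apply] <;> ring
  map_lie' {x y} := by
    have h0 : ⁅x, y⁆ 0 = 0 := rfl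
    have h1 : ⁅x, y⁆ 1 = 0 := rfl
    have h2 : ⁅x, y⁆ 2 = x 0 * y 1 - x 1 * y 0 := rfl
    simp only [h0, h1, h2, Ring.lie_def]
    ext i j
    fin_cases i <;> fin_cases j <;> simp [hMatrix] <;> ring

theorem hMatrixHom_apply (α β : ℂ) (x : ModelFiliform 3) :
    hMatrixHom α β x = hMatrix α β (x 0) (x 1) (x 2) := rfl

theorem hMatrixHom_injective (α β : ℂ) : Function.Injective (hMatrixHom α β) := by
  intro x y h
  simp only [hMatrixHom_apply] at h
  funext k
  fin_cases k
  · simpa [hMatrix] using congrFun (congrFun h 0) 3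
  · simpa [hMatrix] using congrFun (congrFun h 1) 3
  · simpa [hMatrix] using congrFun (congrFun h 2) 3

theorem mem_range_hMatrixHom (α β : ℂ) (X : Matrix (Fin 4) (Fin 4) ℂ) :
    X ∈ (hMatrixHom α β).range ↔ ∃ x₁ x₂ x₃ : ℂ, X = hMatrix α β x₁ x₂ x₃ := by
  rw [LieHom.mem_range]
  constructor
  · rintro ⟨x, rfl⟩
    exact ⟨_, _, _, rfl⟩
  · rintro ⟨x₁, x₂, x₃, rfl⟩
    exact ⟨(![x₁, x₂, x₃] : Fin 3 → ℂ), rfl⟩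

theorem hMatrix_pow_three (α β : ℂ) : hMatrix α β 1 0 0 ^ 3 =
    !![4, 4, 0, 2; 4, 4, 0, 2; 2 * (α + β), 2 * (α + β), 0, α + β; 0, 0, 0, 0] := by
  have h2 : hMatrix α β 1 0 0 ^ 2 =
      !![2, 2, 0, 1; 2, 2, 0, 1; α + β, α + β, 0, α; 0, 0, 0, 0] := by
    rw [pow_two]
    ext i j
    fin_cases i <;> fin_cases j <;> simp [hMatrix, Matrix.mul_apply, Fin.sum_univ_four] <;> norm_num
  rw [pow_succ, h2]
  ext i j
  fin_cases i <;> fin_cases j <;> simp [hMatrix, Matrix.mul_apply, Fin.sum_univ_four] <;> ring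

theorem hMatrix_pow_four (α β : ℂ) :
    hMatrix α β 1 0 0 ^ (3 + 1) = (2 : ℂ) • hMatrix α β 1 0 0 ^ 3 := by
  rw [pow_succ, hMatrix_pow_three]
  ext i j
  fin_cases i <;> fin_cases j <;> simp [hMatrix, Matrix.mul_apply, Fin.sum_univ_four] <;> ring

theorem not_isAlgebraic_range_hMatrixHom (α β : ℂ) : ¬ IsAlgebraic (hMatrixHom α β).range := by
  intro h
  have hmem := h.scaled_pow_mem ((mem_range_hMatrixHom α β _).2 ⟨1, 0, 0, rfl⟩)
    (two_ne_zero (α := ℂ)) (by norm_num) (hMatrix_pow_four α β)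
  obtain ⟨x₁, x₂, x₃, hx⟩ := (mem_range_hMatrixHom α β _).1 hmem
  rw [hMatrix_pow_three] at hx
  have h₁ := congrFun (congrFun hx 0) 3
  have h₂ := congrFun (congrFun hx 1) 3
  have h₃ := congrFun (congrFun hx 2) 0
  simp [hMatrix] at h₁ h₂ h₃
  have : (1 : ℂ) = 0 := by
    -- The last column forces `x₁ = x₂ = 1/2`; the lower left entry would then be both `(α + β) / 2`
    -- and `(α + β - 1) / 2`.
    rw [← h₁, ← h₂] at h₃
    linear_combination 2 * h₃
  exact one_ne_zero this

end LowDimension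

/-! ### The matrices `X_k` on coordinate vectors, and their commutation relations. -/

section Filiform

open scoped Nat

variable {n : ℕ}

/-- The coordinate vector number `p`, replaced by zero for `n ≤ p`. -/
noncomputable def stdVec (n p : ℕ) : Fin (n + 1) → ℂ :=
  fun i => if (i : ℕ) = p ∧ p < n then 1 else 0

/-- The cut-off lets weighted shifts be written without boundary cases. Index `n` is cut off too,
since that coordinate is `lastVec`, on which the matrices act differently. -/
theorem stdVec_of_le {p : ℕ} (h : n ≤ p) : stdVec n p = 0 := by
  funext i
  simp [stdVec, h]

theorem mulVec_stdVec (M : Matrix (Fin (n + 1)) (Fin (n + 1)) ℂ) {p : ℕ} (hp : p < n) :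
    M *ᵥ stdVec n p = fun i => M i ⟨p, by omega⟩ := by
  have : stdVec n p = Pi.single ⟨p, by omega⟩ 1 := by
    funext i
    simp [stdVec, hp, Pi.single_apply, Fin.ext_iff]
  rw [this, mulVec_single_one]
  rfl

/-- The last coordinate vector. -/
noncomputable def lastVec (n : ℕ) : Fin (n + 1) → ℂ := Pi.single (Fin.last n) 1

theorem mulVec_lastVec (M : Matrix (Fin (n + 1)) (Fin (n + 1)) ℂ) :
    M *ᵥ lastVec n = fun i => M i (Fin.last n) := by
  rw [lastVec, mulVec_single_one]
  rfl

theorem matrix_ext_of_mulVec {M N : Matrix (Fin (n + 1)) (Fin (n + 1)) ℂ}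
    (h0 : M *ᵥ stdVec n 0 = N *ᵥ stdVec n 0) (h1 : M *ᵥ stdVec n 1 = N *ᵥ stdVec n 1)
    (h2 : ∀ p, M *ᵥ stdVec n (p + 2) = N *ᵥ stdVec n (p + 2))
    (hl : M *ᵥ lastVec n = N *ᵥ lastVec n) : M = N := by
  ext i ⟨p, hp⟩
  rcases (Nat.lt_succ_iff.1 hp).lt_or_eq with h | rfl
  · have hall : M *ᵥ stdVec n p = N *ᵥ stdVec n p := by
      rcases p with _ | _ | p
      exacts [h0, h1, h2 p]
    rw [mulVec_stdVec _ h, mulVec_stdVec _ h] at hall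
    exact congrFun hall i
  · rw [mulVec_lastVec, mulVec_lastVec] at hl
    exact congrFun hl i

variable (a α β : ℂ)

theorem matX₁_mulVec_zero (hn : 4 ≤ n) : matX₁ n a α β *ᵥ stdVec n 0 =
    a • stdVec n 0 + a • stdVec n 1 + α • stdVec n (n - 1) := by
  rw [mulVec_stdVec _ (by omega)]
  funext i
  simp only [matX₁, of_apply, and_true, stdVec, Pi.add_apply,
    Pi.smul_apply, smul_eq_mul]
  split_ifs <;> first | omega | exact (‹_ ∧ False› : _ ∧ False).2.elim | simp

theorem matX₁_mulVec_one (hn : 4 ≤ n) : matX₁ n a α β *ᵥ stdVec n 1 =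
    a • stdVec n 0 + a • stdVec n 1 + β • stdVec n (n - 1) := by
  rw [mulVec_stdVec _ (by omega)]
  funext i
  simp only [matX₁, of_apply, and_true, stdVec, Pi.add_apply,
    Pi.smul_apply, smul_eq_mul]
  split_ifs <;> first | omega | exact (‹_ ∧ False› : _ ∧ False).2.elim | simp

theorem matX₁_mulVec_add_two (p : ℕ) : matX₁ n a α β *ᵥ stdVec n (p + 2) =
    ((p + 1 : ℂ) / (p + 2)) • stdVec n (p + 3) := by
  by_cases hp : p + 2 < n
  · rw [mulVec_stdVec _ hp]
    funext i
    simp only [matX₁, of_apply, stdVec, Pi.smul_apply, smul_eq_mul]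
    split_ifs <;> first | omega | exact (‹_ ∧ False› : _ ∧ False).2.elim | (push_cast; ring)
  · rw [stdVec_of_le (by omega), stdVec_of_le (by omega), mulVec_zero, smul_zero]

theorem matX₁_mulVec_lastVec (hn : 4 ≤ n) : matX₁ n a α β *ᵥ lastVec n = stdVec n 0 := by
  rw [mulVec_lastVec]
  funext i
  simp only [matX₁, of_apply, and_true, stdVec, Fin.val_last]
  split_ifs <;> first | omega | exact (‹_ ∧ False› : _ ∧ False).2.elim | simp

theorem matX₁_mulVec_penultimate (hn : 4 ≤ n) : matX₁ n a α β *ᵥ stdVec n (n - 1) = 0 := by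
  obtain ⟨p, rfl⟩ : ∃ p, n = p + 3 := ⟨n - 3, by omega⟩
  rw [show p + 3 - 1 = p + 2 by omega, matX₁_mulVec_add_two, stdVec_of_le le_rfl, smul_zero]

theorem matX₂_mulVec_zero (hn : 4 ≤ n) : matX₂ n a α β *ᵥ stdVec n 0 =
    a • stdVec n 0 + a • stdVec n 1 - stdVec n 2 + β • stdVec n (n - 1) := by
  rw [mulVec_stdVec _ (by omega)]
  funext i
  simp only [matX₂, of_apply, and_true, stdVec, Pi.add_apply,
    Pi.sub_apply, Pi.smul_apply, smul_eq_mul]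
  split_ifs <;> first | omega | exact (‹_ ∧ False› : _ ∧ False).2.elim | simp

theorem matX₂_mulVec_one (hn : 4 ≤ n) : matX₂ n a α β *ᵥ stdVec n 1 =
    a • stdVec n 0 + a • stdVec n 1 + stdVec n 2 + α • stdVec n (n - 1) := by
  rw [mulVec_stdVec _ (by omega)]
  funext i
  simp only [matX₂, of_apply, and_true, stdVec, Pi.add_apply,
    Pi.smul_apply, smul_eq_mul]
  split_ifs <;> first | omega | exact (‹_ ∧ False› : _ ∧ False).2.elim | simp

theorem matX₂_mulVec_add_two (p : ℕ) : matX₂ n a α β *ᵥ stdVec n (p + 2) =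
    (1 / (p + 2) : ℂ) • stdVec n (p + 3) := by
  by_cases hp : p + 2 < n
  · rw [mulVec_stdVec _ hp]
    funext i
    simp only [matX₂, of_apply, stdVec, Pi.smul_apply, smul_eq_mul]
    split_ifs <;> first | omega | exact (‹_ ∧ False› : _ ∧ False).2.elim | (push_cast; ring)
  · rw [stdVec_of_le (by omega), stdVec_of_le (by omega), mulVec_zero, smul_zero]

theorem matX₂_mulVec_lastVec (hn : 4 ≤ n) : matX₂ n a α β *ᵥ lastVec n = stdVec n 1 := by
  rw [mulVec_lastVec]
  funext i
  simp only [matX₂, of_apply, and_true, stdVec, Fin.val_last]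
  split_ifs <;> first | omega | exact (‹_ ∧ False› : _ ∧ False).2.elim | simp

theorem matX₂_mulVec_penultimate (hn : 4 ≤ n) : matX₂ n a α β *ᵥ stdVec n (n - 1) = 0 := by
  obtain ⟨p, rfl⟩ : ∃ p, n = p + 3 := ⟨n - 3, by omega⟩
  rw [show p + 3 - 1 = p + 2 by omega, matX₂_mulVec_add_two, stdVec_of_le le_rfl, smul_zero]

theorem genX_mulVec_succ (k : ℕ) (v : Fin (n + 1) → ℂ) : genX n a α β (k + 2) *ᵥ v =
    matX₁ n a α β *ᵥ (genX n a α β (k + 1) *ᵥ v) -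
      genX n a α β (k + 1) *ᵥ (matX₁ n a α β *ᵥ v) := by
  rw [genX, Ring.lie_def, sub_mulVec, mulVec_mulVec, mulVec_mulVec]

/-- In the rescaled basis `w_q = stdVec n q / (q - 1)`, `q ≥ 2`, `X₁` is the plain shift and `X₂`
the shift with weights `1 / (q - 1)`. Bracketing with `X₁` takes differences of the weights, and the
iterated differences of `1 / m` are `k! / (m (m + 1) ⋯ (m + k))`. -/
theorem genX_mulVec_add_two (k p : ℕ) : genX n a α β (k + 1) *ᵥ stdVec n (p + 2) =
    ((k ! * (p + 1)! : ℂ) / (p + k + 2)!) • stdVec n (p + k + 3) := by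
  induction k generalizing p with
  | zero =>
    rw [zero_add, genX, matX₂_mulVec_add_two]
    congr 1
    have := Nat.cast_ne_zero (R := ℂ).2 (p + 1).factorial_ne_zero
    have : (p + 2 : ℂ) ≠ 0 := by exact_mod_cast (p + 1).succ_ne_zero
    rw [add_zero, Nat.factorial_succ (p + 1)]
    have : (p + 1 + 1 : ℂ) ≠ 0 := by exact_mod_cast (p + 1).succ_ne_zero
    push_cast
    field_simp
    ring
  | succ k ih =>
    have h₂ : (p + 2 : ℂ) ≠ 0 := by exact_mod_cast (p + 1).succ_ne_zero
    have h₃ : (p + k + 3 : ℂ) ≠ 0 := by exact_mod_cast (p + k + 2).succ_ne_zero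
    have h₄ := Nat.cast_ne_zero (R := ℂ).2 (p + k + 2).factorial_ne_zero
    rw [genX_mulVec_succ, ih, matX₁_mulVec_add_two, mulVec_smul, mulVec_smul,
      show p + k + 3 = (p + k + 1) + 2 by ring, matX₁_mulVec_add_two, show p + 3 = (p + 1) + 2 by ring,
      ih, smul_smul, smul_smul, show p + 1 + k + 3 = p + (k + 1) + 3 by ring,
      show p + k + 1 + 3 = p + (k + 1) + 3 by ring, ← sub_smul,
      show p + 1 + k + 2 = (p + k + 2) + 1 by ring, show p + (k + 1) + 2 = (p + k + 2) + 1 by ring,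
      Nat.factorial_succ (p + k + 2), Nat.factorial_succ k, Nat.factorial_succ (p + 1)]
    congr 1
    push_cast
    have h₅ : (p + k + 2 + 1 : ℂ) ≠ 0 := by convert h₃ using 1; ring
    have h₆ : (p + k + 1 + 2 : ℂ) ≠ 0 := by convert h₃ using 1; ring
    field_simp
    ring

theorem genX_mulVec_penultimate (hn : 4 ≤ n) (k : ℕ) :
    genX n a α β (k + 1) *ᵥ stdVec n (n - 1) = 0 := by
  obtain ⟨p, rfl⟩ : ∃ p, n = p + 3 := ⟨n - 3, by omega⟩
  rw [show p + 3 - 1 = p + 2 by omega, genX_mulVec_add_two, stdVec_of_le (by omega), smul_zero]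

/-- The action of `X₃, X₄, …` on the first two and the last coordinate vectors. -/
theorem genX_mulVec_special (hn : 4 ≤ n) (k : ℕ) :
    genX n a α β (k + 2) *ᵥ stdVec n 0 = (-1 / (k + 2) : ℂ) • stdVec n (k + 3) ∧
    genX n a α β (k + 2) *ᵥ stdVec n 1 = (1 / (k + 2) : ℂ) • stdVec n (k + 3) ∧
    genX n a α β (k + 2) *ᵥ lastVec n = stdVec n (k + 2) := by
  have hX₁ := matX₁_mulVec_add_two (n := n) a α β
  induction k with
  | zero =>
    have h2 : matX₁ n a α β *ᵥ stdVec n 2 = (1 / 2 : ℂ) • stdVec n 3 := by simpa using hX₁ 0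
    simp only [genX_mulVec_succ _ _ _ 0, zero_add, show genX n a α β 1 = matX₂ n a α β from rfl,
      matX₁_mulVec_zero a α β hn,
      matX₁_mulVec_one a α β hn, matX₂_mulVec_zero a α β hn, matX₂_mulVec_one a α β hn,
      matX₁_mulVec_lastVec a α β hn, matX₂_mulVec_lastVec a α β hn, mulVec_add, mulVec_sub,
      mulVec_smul, matX₁_mulVec_penultimate a α β hn, matX₂_mulVec_penultimate a α β hn, h2,
      Nat.cast_zero]
    refine ⟨?_, ?_, ?_⟩ <;> module
  | succ k ih =>
    have h3 : matX₁ n a α β *ᵥ stdVec n (k + 3) = ((k + 2 : ℂ) / (k + 3)) • stdVec n (k + 4) := by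
      rw [hX₁ (k + 1)]
      push_cast
      congr 2 <;> ring
    have h2 := hX₁ k
    have h₂ : (k + 2 : ℂ) ≠ 0 := by exact_mod_cast (k + 1).succ_ne_zero
    have h₃ : (k + 3 : ℂ) ≠ 0 := by exact_mod_cast (k + 2).succ_ne_zero
    have h₄ : (k + 1 + 2 : ℂ) ≠ 0 := by convert h₃ using 1; ring
    obtain ⟨ih0, ih1, ihl⟩ := ih
    rw [show k + 1 + 2 = (k + 1) + 2 from rfl]
    simp only [genX_mulVec_succ _ _ _ (k + 1), show k + 1 + 1 = k + 2 from rfl, ih0, ih1, ihl,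
      matX₁_mulVec_zero a α β hn, matX₁_mulVec_one a α β hn, matX₁_mulVec_lastVec a α β hn,
      mulVec_add, mulVec_smul, genX_mulVec_penultimate a α β hn (k + 1), h2, h3,
      show k + 1 + 3 = k + 4 from rfl, show k + 1 + 2 = k + 3 from rfl]
    push_cast
    refine ⟨?_, ?_, ?_⟩ <;> match_scalars <;> field_simp <;> ring

theorem genX_mulVec_lastVec (hn : 4 ≤ n) (k : ℕ) :
    genX n a α β k *ᵥ lastVec n = stdVec n k := by
  rcases k with _ | _ | k
  exacts [matX₁_mulVec_lastVec a α β hn, matX₂_mulVec_lastVec a α β hn,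
    (genX_mulVec_special a α β hn k).2.2]

theorem genX_eq_zero (hn : 4 ≤ n) {k : ℕ} (hk : n ≤ k) : genX n a α β k = 0 := by
  obtain ⟨k, rfl⟩ : ∃ l, k = l + 2 := ⟨k - 2, by omega⟩
  obtain ⟨h0, h1, hl⟩ := genX_mulVec_special a α β hn k
  refine matrix_ext_of_mulVec ?_ ?_ (fun p => ?_) ?_
  · rw [h0, stdVec_of_le (by omega), smul_zero, zero_mulVec]
  · rw [h1, stdVec_of_le (by omega), smul_zero, zero_mulVec]
  · rw [genX_mulVec_add_two, stdVec_of_le (by omega), smul_zero, zero_mulVec]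
  · rw [hl, stdVec_of_le (by omega), zero_mulVec]

/-- On the shifted vectors both products have coefficient `(k + 1)! (p + 1)! / (p + k + 4)!`. On the
first two vectors the terms in `a` cancel, because `X_{k+3}` takes opposite values there, and the
`∓1` entries of `X₂` supply what remains. -/
theorem matX₂_lie_genX (hn : 4 ≤ n) (k : ℕ) :
    ⁅matX₂ n a α β, genX n a α β (k + 2)⁆ = 0 := by
  obtain ⟨h0, h1, hl⟩ := genX_mulVec_special a α β hn k
  have hp := genX_mulVec_penultimate a α β hn (k + 1)
  have hg := genX_mulVec_add_two (n := n) a α β (k + 1)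
  have h₂ : (k + 2 : ℂ) ≠ 0 := by exact_mod_cast (k + 1).succ_ne_zero
  have h₃ : (k + 3 : ℂ) ≠ 0 := by exact_mod_cast (k + 2).succ_ne_zero
  have h₄ := Nat.cast_ne_zero (R := ℂ).2 (k + 1).factorial_ne_zero
  have hg2 : genX n a α β (k + 2) *ᵥ stdVec n 2 = (1 / ((k + 2) * (k + 3)) : ℂ) • stdVec n (k + 4) := by
    rw [hg 0, show 0 + (k + 1) + 3 = k + 4 by ring, show 0 + (k + 1) + 2 = k + 1 + 1 + 1 by ring,
      Nat.factorial_succ (k + 1 + 1), Nat.factorial_succ (k + 1)]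
    congr 1
    push_cast
    have h₅ : (k + 1 + 1 : ℂ) ≠ 0 := by convert h₂ using 1; ring
    have h₆ : (k + 1 + 1 + 1 : ℂ) ≠ 0 := by convert h₃ using 1; ring
    simp
    field_simp
    ring
  have hX : matX₂ n a α β *ᵥ stdVec n (k + 3) = (1 / (k + 3) : ℂ) • stdVec n (k + 4) := by
    rw [matX₂_mulVec_add_two a α β (k + 1)]
    push_cast
    congr 2
    ring
  rw [Ring.lie_def, sub_eq_zero]
  refine matrix_ext_of_mulVec ?_ ?_ (fun p => ?_) ?_
  · rw [← mulVec_mulVec, ← mulVec_mulVec, h0, matX₂_mulVec_zero a α β hn]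
    simp only [mulVec_add, mulVec_sub, mulVec_smul, hX, h0, h1, hg2, hp]
    match_scalars
    field_simp
    ring
  · rw [← mulVec_mulVec, ← mulVec_mulVec, h1, matX₂_mulVec_one a α β hn]
    simp only [mulVec_add, mulVec_smul, hX, h0, h1, hg2, hp]
    match_scalars
    field_simp
    ring
  · rw [← mulVec_mulVec, ← mulVec_mulVec, hg, matX₂_mulVec_add_two, mulVec_smul, mulVec_smul,
      show p + (k + 1) + 3 = (p + k + 2) + 2 by ring, matX₂_mulVec_add_two, hg (p + 1), smul_smul,
      smul_smul, show p + 1 + (k + 1) + 3 = p + k + 2 + 3 by ring,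
      show p + 1 + (k + 1) + 2 = p + (k + 1) + 2 + 1 by ring,
      Nat.factorial_succ (p + (k + 1) + 2), Nat.factorial_succ (p + 1)]
    congr 1
    have h₂ : (p + 2 : ℂ) ≠ 0 := by exact_mod_cast (p + 1).succ_ne_zero
    have h₃ : (p + k + 4 : ℂ) ≠ 0 := by exact_mod_cast (p + k + 3).succ_ne_zero
    have h₄ := Nat.cast_ne_zero (R := ℂ).2 (p + (k + 1) + 2).factorial_ne_zero
    push_cast
    have h₅ : (p + (k + 1) + 2 + 1 : ℂ) ≠ 0 := by convert h₃ using 1; ring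
    have h₆ : (p + k + 2 + 2 : ℂ) ≠ 0 := by convert h₃ using 1; ring
    field_simp
    ring
  · rw [← mulVec_mulVec, ← mulVec_mulVec, hl, matX₂_mulVec_lastVec a α β hn, h1,
      matX₂_mulVec_add_two]

/-- By the Jacobi identity, raising the first index costs only a bracket with the second index
raised, so everything reduces to brackets with `X₂`. -/
theorem genX_lie_genX_eq_zero (hn : 4 ≤ n) (i j : ℕ) :
    ⁅genX n a α β (i + 1), genX n a α β (j + 1)⁆ = 0 := by
  induction i generalizing j with
  | zero =>
    rcases j with _ | j
    · exact lie_self _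
    · exact matX₂_lie_genX a α β hn j
  | succ i ih =>
    rw [show genX n a α β (i + 1 + 1) = ⁅matX₁ n a α β, genX n a α β (i + 1)⁆ from rfl, lie_lie, ih,
      lie_zero,
      show ⁅matX₁ n a α β, genX n a α β (j + 1)⁆ = genX n a α β (j + 1 + 1) from rfl, ih, sub_zero]

end Filiform

/-! ### The isomorphism of the model filiform algebra with `h_n`. -/

section FiliformHom

variable {n : ℕ} (a α β : ℂ)

/-- The linear map `e_k ↦ X_k`. -/
noncomputable def genXLinear (n : ℕ) (a α β : ℂ) :
    ModelFiliform n →ₗ[ℂ] Matrix (Fin (n + 1)) (Fin (n + 1)) ℂ where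
  toFun x := ∑ k : Fin n, x k • genX n a α β k
  map_add' x y := by simp only [ModelFiliform.add_apply, add_smul, Finset.sum_add_distrib]
  map_smul' c x := by
    simp only [ModelFiliform.smul_apply, mul_smul, Finset.smul_sum, RingHom.id_apply]

theorem genXLinear_apply (x : ModelFiliform n) :
    genXLinear n a α β x = ∑ k : Fin n, x k • genX n a α β k := rfl

theorem genXLinear_e (k : Fin n) :
    genXLinear n a α β (ModelFiliform.e n k) = genX n a α β k := by
  rw [genXLinear_apply, Finset.sum_eq_single k]
  · simp [ModelFiliform.e_apply]
  · intro j _ hj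
    rw [ModelFiliform.e_apply, if_neg (fun h => hj (Fin.ext h)), zero_smul]
  · simp

theorem genXLinear_bracket_e_first (hn : 4 ≤ n) (j : Fin n) (hj : 1 ≤ (j : ℕ)) :
    genXLinear n a α β ⁅ModelFiliform.e n ⟨0, by omega⟩, ModelFiliform.e n j⁆ =
      ⁅genX n a α β 0, genX n a α β j⁆ := by
  have hstep : ⁅genX n a α β 0, genX n a α β j⁆ = genX n a α β (j + 1) := by
    obtain ⟨l, hl⟩ : ∃ l, (j : ℕ) = l + 1 := ⟨j - 1, by omega⟩
    rw [hl]
    rfl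
  rw [hstep]
  by_cases h : (j : ℕ) + 1 < n
  · rw [ModelFiliform.bracket_e_first j hj h, genXLinear_e]
  · have : j = ⟨n - 1, by omega⟩ := Fin.ext (by simp only; omega)
    rw [genX_eq_zero a α β hn (by omega), this, ModelFiliform.bracket_e_last (by omega), map_zero]

theorem genXLinear_bracket_e (hn : 4 ≤ n) (i j : Fin n) :
    genXLinear n a α β ⁅ModelFiliform.e n i, ModelFiliform.e n j⁆ =
      ⁅genX n a α β i, genX n a α β j⁆ := by
  rcases Nat.eq_zero_or_pos i with hi | hi <;> rcases Nat.eq_zero_or_pos j with hj | hj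
  · obtain rfl : i = j := Fin.ext (hi.trans hj.symm)
    rw [lie_self, lie_self, map_zero]
  · have hi0 : i = ⟨0, j.pos⟩ := Fin.ext hi
    subst hi0
    exact genXLinear_bracket_e_first a α β hn j hj
  · have hj0 : j = ⟨0, i.pos⟩ := Fin.ext hj
    subst hj0
    rw [← lie_skew, map_neg, genXLinear_bracket_e_first a α β hn i hi, lie_skew]
  · rw [ModelFiliform.bracket_e_e i j hi hj, map_zero]
    obtain ⟨k, hk⟩ : ∃ l, (i : ℕ) = l + 1 := ⟨i - 1, by omega⟩
    obtain ⟨l, hl⟩ : ∃ l, (j : ℕ) = l + 1 := ⟨j - 1, by omega⟩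
    rw [hk, hl, genX_lie_genX_eq_zero a α β hn]

/-- The homomorphism of Lie algebras `e_k ↦ X_k`. -/
noncomputable def genXHom (hn : 4 ≤ n) :
    ModelFiliform n →ₗ⁅ℂ⁆ Matrix (Fin (n + 1)) (Fin (n + 1)) ℂ :=
  { genXLinear n a α β with
    map_lie' := by
      intro x y
      change genXLinear n a α β ⁅x, y⁆ = ⁅genXLinear n a α β x, genXLinear n a α β y⁆
      conv_lhs => rw [ModelFiliform.eq_sum_e x, ModelFiliform.eq_sum_e y]
      simp only [genXLinear_apply _ _ _ x, genXLinear_apply _ _ _ y, sum_lie, lie_sum, smul_lie,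
        lie_smul, map_sum, map_smul, genXLinear_bracket_e a α β hn] }

theorem genXHom_apply (hn : 4 ≤ n) (x : ModelFiliform n) :
    genXHom a α β hn x = ∑ k : Fin n, x k • genX n a α β k := rfl

theorem genXHom_e (hn : 4 ≤ n) (k : Fin n) :
    genXHom a α β hn (ModelFiliform.e n k) = genX n a α β k :=
  genXLinear_e a α β k

theorem genXHom_mulVec_lastVec (hn : 4 ≤ n) (x : ModelFiliform n) (j : Fin n) :
    (genXHom a α β hn x *ᵥ lastVec n) j.castSucc = x j := by
  rw [genXHom_apply, sum_mulVec, Finset.sum_apply, Finset.sum_eq_single j]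
  · simp [smul_mulVec, genX_mulVec_lastVec a α β hn, stdVec]
  · intro k _ hk
    have : (j : ℕ) ≠ k := fun h => hk (Fin.ext h.symm)
    simp [smul_mulVec, genX_mulVec_lastVec a α β hn, stdVec, this]
  · simp

/-- The last column of `∑ x_k X_k` is the coordinate vector `x`. -/
theorem genXHom_injective (hn : 4 ≤ n) : Function.Injective (genXHom a α β hn) := fun x y h =>
  funext fun j => by
    rw [← genXHom_mulVec_lastVec a α β hn x j, h, genXHom_mulVec_lastVec]

theorem range_genXHom (hn : 4 ≤ n) : (genXHom a α β hn).range = hAlg n a α β := by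
  apply le_antisymm
  · rintro _ ⟨x, rfl⟩
    change ∑ k : Fin n, x k • genX n a α β k ∈ hAlg n a α β
    exact sum_mem fun k _ => (hAlg n a α β).smul_mem _ (LieSubalgebra.subset_lieSpan ⟨k, rfl⟩)
  · refine LieSubalgebra.lieSpan_le.2 ?_
    rintro _ ⟨k, rfl⟩
    exact (LieHom.mem_range _ _).2 ⟨_, genXHom_e a α β hn k⟩

/-- The isomorphism of the model filiform Lie algebra with `h_n`. -/
noncomputable def filiformEquiv (hn : 4 ≤ n) : ModelFiliform n ≃ₗ⁅ℂ⁆ hAlg n a α β :=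
  (LieEquiv.ofInjective (genXHom a α β hn) (genXHom_injective a α β hn)).trans
    (LieEquiv.ofEq _ _ (congrArg _ (range_genXHom a α β hn)))

theorem coe_filiformEquiv_e (hn : 4 ≤ n) (k : Fin n) :
    (filiformEquiv a α β hn (ModelFiliform.e n k) : Matrix (Fin (n + 1)) (Fin (n + 1)) ℂ) =
      genX n a α β k :=
  genXHom_e a α β hn k

/-- A linear relation between matrix entries that holds on `h_n`. -/
theorem entry_eq_neg_of_mem_hAlg (hn : 4 ≤ n) {M : Matrix (Fin (n + 1)) (Fin (n + 1)) ℂ}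
    (hM : M ∈ hAlg n a α β) :
    (M *ᵥ stdVec n 0) ⟨2, by omega⟩ = -(M *ᵥ lastVec n) ⟨1, by omega⟩ := by
  rw [← range_genXHom a α β hn, LieHom.mem_range] at hM
  obtain ⟨x, rfl⟩ := hM
  rw [genXHom_apply, sum_mulVec, sum_mulVec, Finset.sum_apply, Finset.sum_apply,
    ← Finset.sum_neg_distrib]
  refine Finset.sum_congr rfl fun k _ => ?_
  have h2 : 2 ≠ n - 1 := by omega
  have h2n : 2 < n := by omega
  have h1n : 1 < n := by omega
  rw [smul_mulVec, smul_mulVec, Pi.smul_apply, Pi.smul_apply, ← smul_neg,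
    genX_mulVec_lastVec a α β hn]
  congr 1
  -- Among the generators only `X₂` is nonzero in these two places, with entries `-1` and `1`; `α`
  -- and `β` stay away from row 2 because `n - 1 ≥ 3`.
  rcases (k : ℕ) with _ | _ | k
  · rw [genX, matX₁_mulVec_zero a α β hn]
    simp [stdVec, h2]
  · rw [zero_add, genX, matX₂_mulVec_zero a α β hn]
    simp [stdVec, h2, h2n, h1n]
  · rw [(genX_mulVec_special a α β hn k).1]
    simp [stdVec]

end FiliformHom

/-! ### Powers of `X₁` and its semisimple part. -/

section Powers

variable {n : ℕ} (a α β : ℂ)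

theorem matX₁_pow_mulVec_add_two {j p : ℕ} (h : n ≤ p + 2 + j) :
    matX₁ n a α β ^ j *ᵥ stdVec n (p + 2) = 0 := by
  induction j generalizing p with
  | zero => rw [stdVec_of_le (by omega), mulVec_zero]
  | succ j ih =>
    rw [pow_succ, ← mulVec_mulVec, matX₁_mulVec_add_two, mulVec_smul,
      show p + 3 = (p + 1) + 2 by ring, ih (by omega), smul_zero]

theorem matX₁_sq_mulVec_zero (hn : 4 ≤ n) : matX₁ n a α β ^ 2 *ᵥ stdVec n 0 =
    (2 * a * a) • stdVec n 0 + (2 * a * a) • stdVec n 1 + (a * (α + β)) • stdVec n (n - 1) := by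
  rw [pow_two, ← mulVec_mulVec, matX₁_mulVec_zero a α β hn]
  simp only [mulVec_add, mulVec_smul, matX₁_mulVec_zero a α β hn, matX₁_mulVec_one a α β hn,
    matX₁_mulVec_penultimate a α β hn]
  module

theorem matX₁_sq_mulVec_one (hn : 4 ≤ n) :
    matX₁ n a α β ^ 2 *ᵥ stdVec n 1 = matX₁ n a α β ^ 2 *ᵥ stdVec n 0 := by
  rw [matX₁_sq_mulVec_zero a α β hn, pow_two, ← mulVec_mulVec, matX₁_mulVec_one a α β hn]
  simp only [mulVec_add, mulVec_smul, matX₁_mulVec_zero a α β hn, matX₁_mulVec_one a α β hn,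
    matX₁_mulVec_penultimate a α β hn]
  module

/-- `X₁ ^ 2` sends the first coordinate vector to an eigenvector of `X₁` with eigenvalue `2a`, the
nonzero eigenvalue of the 2 by 2 block. -/
theorem matX₁_pow_mulVec_zero (hn : 4 ≤ n) (j : ℕ) :
    matX₁ n a α β ^ (j + 2) *ᵥ stdVec n 0 =
      (2 * a) ^ j • (matX₁ n a α β ^ 2 *ᵥ stdVec n 0) := by
  induction j with
  | zero => simp
  | succ j ih =>
    rw [add_right_comm, pow_succ', ← mulVec_mulVec, ih, mulVec_smul, pow_succ (2 * a), mul_smul]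
    congr 1
    rw [matX₁_sq_mulVec_zero a α β hn]
    simp only [mulVec_add, mulVec_smul, matX₁_mulVec_zero a α β hn, matX₁_mulVec_one a α β hn,
      matX₁_mulVec_penultimate a α β hn]
    module

/-- For `X₁` it suffices to check `X₁ᵏ⁺¹ = 2a X₁ᵏ` on the last coordinate vector. -/
theorem matX₁_pow_succ_of_lastVec (hn : 4 ≤ n) {k : ℕ} (hk : n ≤ k + 2)
    (hl : matX₁ n a α β ^ (k + 1) *ᵥ lastVec n = (2 * a) • (matX₁ n a α β ^ k *ᵥ lastVec n)) :
    matX₁ n a α β ^ (k + 1) = (2 * a) • matX₁ n a α β ^ k := by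
  obtain ⟨j, rfl⟩ : ∃ j, k = j + 2 := ⟨k - 2, by omega⟩
  have h0 : matX₁ n a α β ^ (j + 2 + 1) *ᵥ stdVec n 0 =
      ((2 * a) • matX₁ n a α β ^ (j + 2)) *ᵥ stdVec n 0 := by
    rw [smul_mulVec, add_right_comm, matX₁_pow_mulVec_zero a α β hn (j + 1),
      matX₁_pow_mulVec_zero a α β hn j, pow_succ' (2 * a), mul_smul]
  have hone (i : ℕ) : matX₁ n a α β ^ (i + 2) *ᵥ stdVec n 1 =
      matX₁ n a α β ^ (i + 2) *ᵥ stdVec n 0 := by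
    rw [pow_add, ← mulVec_mulVec, ← mulVec_mulVec, matX₁_sq_mulVec_one a α β hn]
  refine matrix_ext_of_mulVec h0 ?_ (fun p => ?_) (by rw [hl, smul_mulVec])
  · rw [smul_mulVec, hone j, ← smul_mulVec, ← h0, add_right_comm, hone (j + 1)]
  · rw [smul_mulVec, matX₁_pow_mulVec_add_two a α β (by omega),
      matX₁_pow_mulVec_add_two a α β (by omega), smul_zero]

theorem matX₁_pow_mulVec_lastVec (hn : 4 ≤ n) (j : ℕ) :
    matX₁ n a α β ^ (j + 1) *ᵥ lastVec n = matX₁ n a α β ^ j *ᵥ stdVec n 0 := by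
  rw [pow_succ, ← mulVec_mulVec, matX₁_mulVec_lastVec a α β hn]

/-- The condition `n ≤ k + 2` kills the shift part. The last vector needs one step to reach the
first and two more to reach an eigenvector, hence `3 ≤ k`. So `k = n - 1` always works, and `k = n -
2` works for `5 ≤ n`. -/
theorem matX₁_pow_succ (hn : 4 ≤ n) {k : ℕ} (hk : n ≤ k + 2) (hk3 : 3 ≤ k) :
    matX₁ n a α β ^ (k + 1) = (2 * a) • matX₁ n a α β ^ k := by
  refine matX₁_pow_succ_of_lastVec a α β hn hk ?_
  obtain ⟨j, rfl⟩ : ∃ j, k = j + 3 := ⟨k - 3, by omega⟩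
  rw [matX₁_pow_mulVec_lastVec a α β hn, show j + 3 = (j + 1) + 2 by ring,
    matX₁_pow_mulVec_zero a α β hn (j + 1), show j + 1 + 2 = (j + 2) + 1 by ring,
    matX₁_pow_mulVec_lastVec a α β hn, matX₁_pow_mulVec_zero a α β hn j, pow_succ', mul_smul]

/-- For `α = β` already `X₁` itself sends the first vector to an eigenvector, which saves one step
and admits `k = n - 2` for `n = 4`. -/
theorem matX₁_pow_succ_of_eq (hn : 4 ≤ n) {k : ℕ} (hk : n ≤ k + 2) :
    matX₁ n a α α ^ (k + 1) = (2 * a) • matX₁ n a α α ^ k := by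
  refine matX₁_pow_succ_of_lastVec a α α hn hk ?_
  obtain ⟨j, rfl⟩ : ∃ j, k = j + 2 := ⟨k - 2, by omega⟩
  rw [matX₁_pow_mulVec_lastVec a α α hn, show j + 2 = (j + 1) + 1 by ring,
    matX₁_pow_mulVec_lastVec a α α hn, show j + 1 + 1 = j + 2 by ring, pow_add _ j 2,
    pow_succ _ j, ← mulVec_mulVec, ← mulVec_mulVec, ← mulVec_smul, matX₁_sq_mulVec_zero a α α hn,
    matX₁_mulVec_zero a α α hn]
  congr 1
  module

theorem semisimplePart_notMem_hAlg (hn : 4 ≤ n) (ha : a ≠ 0) :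
    ((2 * a) ^ (n - 2))⁻¹ • matX₁ n a α β ^ (n - 1) ∉ hAlg n a α β := by
  intro h
  have hrel := entry_eq_neg_of_mem_hAlg a α β hn h
  obtain ⟨j, rfl⟩ : ∃ j, n = j + 4 := ⟨n - 4, by omega⟩
  rw [smul_mulVec, smul_mulVec, show j + 4 - 1 = (j + 2) + 1 by omega,
    matX₁_pow_mulVec_lastVec a α β hn, show j + 2 + 1 = (j + 1) + 2 by ring,
    matX₁_pow_mulVec_zero a α β hn (j + 1), matX₁_pow_mulVec_zero a α β hn j,
    matX₁_sq_mulVec_zero a α β hn] at hrel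
  -- The image of the first vector has no component of index 2, while the last column has a nonzero
  -- multiple of `a ^ 2` at index 1.
  simp [stdVec, ha] at hrel

theorem not_isAlgebraic_hAlg (hn : 4 ≤ n) (ha : a ≠ 0) : ¬ IsAlgebraic (hAlg n a α β) := by
  intro h
  refine semisimplePart_notMem_hAlg a α β hn ha ?_
  have hmem : matX₁ n a α β ∈ hAlg n a α β :=
    LieSubalgebra.subset_lieSpan ⟨⟨0, by omega⟩, rfl⟩
  have := h.scaled_pow_mem hmem (mul_ne_zero two_ne_zero ha) (k := n - 1) (by omega)
    (matX₁_pow_succ a α β hn (by omega) (by omega))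
  rwa [show n - 1 - 1 = n - 2 by omega] at this

end Powers

/-! ### Assembly of the theorem. -/

/-- The matrices `hMatrix α β x₁ x₂ x₃` form a nilpotent Lie algebra that is not algebraic. -/
theorem exists_lieSubalgebra_hMatrix (α β : ℂ) : ∃ L : LieSubalgebra ℂ (Matrix (Fin 4) (Fin 4) ℂ),
    (∀ X : Matrix (Fin 4) (Fin 4) ℂ, X ∈ L ↔ ∃ x₁ x₂ x₃ : ℂ, X = hMatrix α β x₁ x₂ x₃) ∧
      Module.finrank ℂ L = 3 ∧ LieRing.IsNilpotent L ∧ ¬ IsAlgebraic L := by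
  let φ := LieEquiv.ofInjective (hMatrixHom α β) (hMatrixHom_injective α β)
  exact ⟨(hMatrixHom α β).range, mem_range_hMatrixHom α β,
    φ.toLinearEquiv.finrank_eq.symm.trans (ModelFiliform.finrank_eq 3),
    φ.nilpotent_iff_equiv_nilpotent.1 (ModelFiliform.isNilpotent 3),
    not_isAlgebraic_range_hMatrixHom α β⟩

end NonAlgebraicNilpotent

theorem mainTheorem2 :
    (∀ n : ℕ, 3 ≤ n →
      ∃ (m : ℕ) (L : LieSubalgebra ℂ (Matrix (Fin m) (Fin m) ℂ)),
        Module.finrank ℂ L = n ∧ LieRing.IsNilpotent L ∧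
          ¬ NonAlgebraicNilpotent.IsAlgebraic L) ∧
    (∀ α β : ℂ, α + β ≠ 0 →
      ∃ L : LieSubalgebra ℂ (Matrix (Fin 4) (Fin 4) ℂ),
        (∀ X : Matrix (Fin 4) (Fin 4) ℂ,
          X ∈ L ↔ ∃ x₁ x₂ x₃ : ℂ, X = NonAlgebraicNilpotent.hMatrix α β x₁ x₂ x₃) ∧
        Module.finrank ℂ L = 3 ∧ LieRing.IsNilpotent L ∧
        ¬ NonAlgebraicNilpotent.IsAlgebraic L) ∧
    (∀ (n : ℕ), 4 ≤ n → ∀ a α β : ℂ, a ≠ 0 →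
      Module.finrank ℂ (NonAlgebraicNilpotent.hAlg n a α β) = n ∧
      LieRing.IsNilpotent (NonAlgebraicNilpotent.hAlg n a α β) ∧
      (∃ φ : NonAlgebraicNilpotent.ModelFiliform n ≃ₗ⁅ℂ⁆ NonAlgebraicNilpotent.hAlg n a α β,
        ∀ k : Fin n,
          (φ (NonAlgebraicNilpotent.ModelFiliform.e n k) :
            Matrix (Fin (n + 1)) (Fin (n + 1)) ℂ) = NonAlgebraicNilpotent.genX n a α β k) ∧
      (∃ S : Matrix (Fin (n + 1)) (Fin (n + 1)) ℂ,
        NonAlgebraicNilpotent.IsSemisimplePart (NonAlgebraicNilpotent.matX₁ n a α β) S ∧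
        S ∉ NonAlgebraicNilpotent.hAlg n a α β ∧
        S = ((2 * a) ^ (n - 2))⁻¹ • NonAlgebraicNilpotent.matX₁ n a α β ^ (n - 1) ∧
        (5 ≤ n ∨ α = β →
          S = ((2 * a) ^ (n - 3))⁻¹ • NonAlgebraicNilpotent.matX₁ n a α β ^ (n - 2))) ∧
      ¬ NonAlgebraicNilpotent.IsAlgebraic (NonAlgebraicNilpotent.hAlg n a α β)) := by
  open NonAlgebraicNilpotent in
  have hfil (n : ℕ) (hn : 4 ≤ n) (a α β : ℂ) : Module.finrank ℂ (hAlg n a α β) = n ∧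
      LieRing.IsNilpotent (hAlg n a α β) :=
    ⟨(filiformEquiv a α β hn).toLinearEquiv.finrank_eq.symm.trans (ModelFiliform.finrank_eq n),
      (filiformEquiv a α β hn).nilpotent_iff_equiv_nilpotent.1 (ModelFiliform.isNilpotent n)⟩
  refine ⟨fun n hn => ?_, fun α β _ => NonAlgebraicNilpotent.exists_lieSubalgebra_hMatrix α β, fun n hn a α β ha => ?_⟩
  · rcases hn.eq_or_lt with rfl | hn
    · obtain ⟨L, -, hL⟩ := NonAlgebraicNilpotent.exists_lieSubalgebra_hMatrix 1 0
      exact ⟨4, L, hL⟩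
    · exact ⟨n + 1, _, (hfil n hn 1 0 0).1, (hfil n hn 1 0 0).2,
        NonAlgebraicNilpotent.not_isAlgebraic_hAlg 1 0 0 hn one_ne_zero⟩
  · have h2a : 2 * a ≠ 0 := mul_ne_zero two_ne_zero ha
    refine ⟨(hfil n hn a α β).1, (hfil n hn a α β).2,
      ⟨NonAlgebraicNilpotent.filiformEquiv a α β hn,
        NonAlgebraicNilpotent.coe_filiformEquiv_e a α β hn⟩,
      ⟨_, ?_, NonAlgebraicNilpotent.semisimplePart_notMem_hAlg a α β hn ha, rfl, fun h => ?_⟩,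
      NonAlgebraicNilpotent.not_isAlgebraic_hAlg a α β hn ha⟩
    · have := NonAlgebraicNilpotent.isSemisimplePart_scaled_pow h2a (k := n - 1) (by omega)
        (NonAlgebraicNilpotent.matX₁_pow_succ a α β hn (by omega) (by omega))
      rwa [show n - 1 - 1 = n - 2 by omega] at this
    · have hpow : NonAlgebraicNilpotent.matX₁ n a α β ^ (n - 2 + 1) =
          (2 * a) • NonAlgebraicNilpotent.matX₁ n a α β ^ (n - 2) := by
        rcases h with h | rfl
        · exact NonAlgebraicNilpotent.matX₁_pow_succ a α β hn (by omega) (by omega)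
        · exact NonAlgebraicNilpotent.matX₁_pow_succ_of_eq a α hn (by omega)
      rw [show n - 1 = n - 2 + 1 by omega, hpow, smul_smul, show n - 2 = n - 3 + 1 by omega,
        pow_succ (2 * a), mul_inv, inv_mul_cancel_right₀ h2a]
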